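/- Let $X=\begin{bmatrix}0&1\\1&0\end{bmatrix}$, $Y=\begin{bmatrix}0&-i\\i&0\end{bmatrix}$, $Z=\begin{bmatrix}1&0\\0&-1\end{bmatrix}$. An $n$-qubit gate is a $2^n\times 2^n$ unitary matrix, with rows and columns indexed by $\mathbb{F}_2^n$. The Pauli group $\mathcal{P}_n$ is the set of all gates $c\,P_1\otimes\cdots\otimes P_n$ with $c\in\{\pm1,\pm i\}$ and $P_1,\dots,P_n\in\{I_2,X,Y,Z\}$, and the Clifford group on $n$ qubits is the normalizer of $\mathcal{P}_n$ in the unitary group. Put $\mathcal{C}_1=\mathcal{P}_n$ and, for $k\ge 2$, let $\mathcal{C}_k$ be the set of all $n$-qubit gates $U$ such that $UPU^\dagger\in\mathcal{C}_{k-1}$ for all $P\in\mathcal{P}_n$. A gate is a permutation gate if it is a permutation matrix, and it is semi-Clifford if it can be written as $\phi_1 d\phi_2$ with Clifford gates $\phi_1,\phi_2$ and a diagonal gate $d$. Theorem. The smallest number of qubits $n$ for which there exists a non-semi-Clifford permutation gate in $\mathcal{C}_3$ is $7$. Moreover, for every $n\ge 7$ there exists an $n$-qubit permutation gate in $\mathcal{C}_3$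 that is not semi-Clifford, and for every $n\le 6$ every $n$-qubit permutation gate in $\mathcal{C}_3$ is semi-Clifford. -/

import Mathlib

open scoped Matrix

noncomputable section

/-- The tensor product `P₁ ⊗ ⋯ ⊗ Pₙ` of single-qubit matrices, with rows and columns indexed by the
computational basis `𝔽₂ⁿ`. -/
def tensorMatrix {n : ℕ} (P : Fin n → Matrix (ZMod 2) (ZMod 2) ℂ) :
    Matrix (Fin n → ZMod 2) (Fin n → ZMod 2) ℂ :=
  Matrix.of fun a b => ∏ j, P j (a j) (b j)

/-- The single-qubit Pauli gate `X`. -/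
def pauliX : Matrix (ZMod 2) (ZMod 2) ℂ := !![0, 1; 1, 0]

/-- The single-qubit Pauli gate `Y`. -/
def pauliY : Matrix (ZMod 2) (ZMod 2) ℂ := !![0, -Complex.I; Complex.I, 0]

/-- The single-qubit Pauli gate `Z`. -/
def pauliZ : Matrix (ZMod 2) (ZMod 2) ℂ := !![1, 0; 0, -1]

/-- An `n`-qubit gate: a unitary matrix indexed by the computational basis `𝔽₂ⁿ`. -/
abbrev Gate (n : ℕ) : Type := Matrix.unitaryGroup (Fin n → ZMod 2) ℂ

/-- The Pauli group on `n` qubits: all gates `c P₁ ⊗ ⋯ ⊗ Pₙ` with `c ∈ {±1, ±i}` and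
`Pⱼ ∈ {I, X, Y, Z}`. -/
def pauliGroup (n : ℕ) : Set (Gate n) :=
  {U | ∃ c ∈ ({1, -1, Complex.I, -Complex.I} : Set ℂ),
    ∃ P : Fin n → Matrix (ZMod 2) (ZMod 2) ℂ,
      (∀ j, P j ∈ ({1, pauliX, pauliY, pauliZ} : Set (Matrix (ZMod 2) (ZMod 2) ℂ))) ∧
      (U : Matrix (Fin n → ZMod 2) (Fin n → ZMod 2) ℂ) = c • tensorMatrix P}

/-- The Clifford group on `n` qubits: the normalizer of the Pauli group in the unitary group. -/
def cliffordGroup (n : ℕ) : Subgroup (Gate n) := Subgroup.normalizer (pauliGroup n)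

/-- The levels `𝒞ₖ` of the Clifford hierarchy on `n` qubits; they are numbered from `k = 1`, and the
value at `k = 0` is a placeholder that the other levels do not use. -/
def cliffordHierarchy (n : ℕ) : ℕ → Set (Gate n)
  | 0 => ∅
  | 1 => pauliGroup n
  | k + 2 => {U | ∀ P ∈ pauliGroup n, U * P * star U ∈ cliffordHierarchy n (k + 1)}

/-- A permutation gate: its matrix is a `2ⁿ × 2ⁿ` permutation matrix, that is, it permutes the
computational basis states. -/
def IsPermutationGate {n : ℕ} (U : Gate n) : Prop :=
  ∃ σ : Equiv.Perm (Fin n → ZMod 2),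
    (U : Matrix (Fin n → ZMod 2) (Fin n → ZMod 2) ℂ) = σ.permMatrix ℂ

/-- A diagonal gate. -/
def IsDiagonalGate {n : ℕ} (U : Gate n) : Prop :=
  (U : Matrix (Fin n → ZMod 2) (Fin n → ZMod 2) ℂ).IsDiag

/-- A semi-Clifford gate: one of the form `φ₁ d φ₂` with `φ₁`, `φ₂` Clifford and `d` diagonal. -/
def IsSemiClifford {n : ℕ} (U : Gate n) : Prop :=
  ∃ φ₁ ∈ cliffordGroup n, ∃ φ₂ ∈ cliffordGroup n, ∃ d : Gate n,
    IsDiagonalGate d ∧ U = φ₁ * d * φ₂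

end

/-!
Let the permutation gate `permGate f` have the matrix with entries `1` at `(a, f a)`. Conjugation by it
turns `X^v` into the permutation gate of `π_v x = f⁻¹(f x + v)` and `Z^w` into the diagonal gate with
phases `(-1)^(w · f x)`. A permutation gate is Clifford when its permutation is affine, and membership of
`permGate f` in the third level forces every `π_v` to be affine
(`affine_of_mem_cliffordHierarchy_three`).

After composing with a translation, let `f 0 = 0`. The transported group law
`x ∘ y = f⁻¹(f x + f y)` is then affine in each variable, so `x ∘ y = x + y + xy` for a biadditive product
`xy` (`circleProduct`). This product is commutative and associative, and all squares vanish, because `∘` is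
the law of an elementary abelian `2`-group.

*At most six qubits.* If `xyz ≠ 0`, then `x, y, z, xy, xz, yz, xyz` are linearly independent
(`seven_le_finrank_of_mul_mul_ne_zero`); hence in dimension at most six all triple products vanish, and
every `xy` lies in the annihilator `W` of the algebra. Then `f` is additive along `W` and additive modulo
`f W`, so in bases adapted to `W` and `f W` it is a shear: it fixes the coordinates outside a set `S` and
commutes with the translations along `S` (`exists_linearEquiv_shear`). Hadamard gates on `S` exchange `X`
and `Z` there, so the conjugated gate commutes with all `Z^w` and is diagonal
(`isSemiClifford_permGate_of_shear`).

*At least seven qubits.* Let `v` be a second difference of `f`. If `permGate f = φ₁ d φ₂`, the Pauli gates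
`φ₂⁻¹ Z^w φ₂` are conjugated to Pauli gates, which forces them to commute with `X^v`. So
`φ₂ X^v φ₂⁻¹` is diagonal, `permGate f` conjugates `X^v` to a Pauli gate, and `π_v` is a translation
(`exists_translation_of_isSemiClifford`). In terms of the product, this says that `xy` annihilates the
algebra. It fails for the augmentation ideal of the exterior algebra on three generators, which has
dimension seven; `exteriorPerm` is the corresponding permutation, extended by the identity to more qubits.
-/

/-! ### Monomial matrices -/

/-- The monomial matrix whose only nonzero entry in row `a` is `φ a`, in column `π a`. -/
def monomialMatrix {ι : Type*} [DecidableEq ι] (π : Equiv.Perm ι) (φ : ι → ℂ) : Matrix ι ι ℂ :=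
  Matrix.of fun a b => if b = π a then φ a else 0

section Monomial

variable {ι : Type*} [DecidableEq ι]

theorem monomialMatrix_apply (π : Equiv.Perm ι) (φ : ι → ℂ) (a b : ι) :
    monomialMatrix π φ a b = if b = π a then φ a else 0 := rfl

theorem monomialMatrix_one_one : monomialMatrix (1 : Equiv.Perm ι) (fun _ => 1) = 1 := by
  ext a b
  simp [monomialMatrix_apply, Matrix.one_apply, eq_comm]

theorem permMatrix_eq_monomialMatrix (σ : Equiv.Perm ι) :
    σ.permMatrix ℂ = monomialMatrix σ fun _ => 1 := by
  ext a b
  simp [monomialMatrix_apply, Equiv.Perm.permMatrix, PEquiv.toMatrix_apply, eq_comm]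

theorem smul_monomialMatrix (c : ℂ) (π : Equiv.Perm ι) (φ : ι → ℂ) :
    c • monomialMatrix π φ = monomialMatrix π fun x => c * φ x := by
  ext a b
  simp [monomialMatrix_apply]

theorem star_monomialMatrix (π : Equiv.Perm ι) (φ : ι → ℂ) :
    star (monomialMatrix π φ) = monomialMatrix π⁻¹ fun x => star (φ (π⁻¹ x)) := by
  ext a b
  rw [Matrix.star_apply, monomialMatrix_apply, monomialMatrix_apply]
  by_cases h : a = π b
  · subst h
    simp
  · have h' : ¬ b = π⁻¹ a := fun hb => h (by rw [hb]; simp)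
    rw [if_neg h, if_neg h', star_zero]

theorem monomialMatrix_mul_apply [Fintype ι] (π : Equiv.Perm ι) (φ : ι → ℂ) (A : Matrix ι ι ℂ)
    (a b : ι) : (monomialMatrix π φ * A) a b = φ a * A (π a) b := by
  rw [Matrix.mul_apply, Finset.sum_eq_single (π a)]
  · rw [monomialMatrix_apply, if_pos rfl]
  · intro x _ hx
    rw [monomialMatrix_apply, if_neg hx, zero_mul]
  · exact fun h => absurd (Finset.mem_univ _) h

theorem mul_monomialMatrix_apply [Fintype ι] (π : Equiv.Perm ι) (φ : ι → ℂ) (A : Matrix ι ι ℂ)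
    (a b : ι) : (A * monomialMatrix π φ) a (π b) = A a b * φ b := by
  rw [Matrix.mul_apply, Finset.sum_eq_single b]
  · rw [monomialMatrix_apply, if_pos rfl]
  · intro x _ hx
    rw [monomialMatrix_apply, if_neg fun h => hx (π.injective h).symm, mul_zero]
  · exact fun h => absurd (Finset.mem_univ _) h

theorem monomialMatrix_mul [Fintype ι] (π ρ : Equiv.Perm ι) (φ ψ : ι → ℂ) :
    monomialMatrix π φ * monomialMatrix ρ ψ =
      monomialMatrix (ρ * π) fun x => φ x * ψ (π x) := by
  ext a b
  rw [monomialMatrix_mul_apply, monomialMatrix_apply, monomialMatrix_apply, mul_ite, mul_zero]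
  rfl

theorem monomialMatrix_conj [Fintype ι] (π ρ : Equiv.Perm ι) (φ ψ : ι → ℂ) :
    monomialMatrix π φ * monomialMatrix ρ ψ * star (monomialMatrix π φ) =
      monomialMatrix (π⁻¹ * ρ * π) fun x => φ x * ψ (π x) * star (φ (π⁻¹ (ρ (π x)))) := by
  rw [star_monomialMatrix, monomialMatrix_mul, monomialMatrix_mul]
  rfl

theorem monomialMatrix_inj {π ρ : Equiv.Perm ι} {φ ψ : ι → ℂ} (hφ : ∀ x, φ x ≠ 0)
    (h : monomialMatrix π φ = monomialMatrix ρ ψ) : π = ρ ∧ φ = ψ := by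
  have key : ∀ a, π a = ρ a ∧ φ a = ψ a := by
    intro a
    have h1 := congrFun (congrFun h a) (π a)
    rw [monomialMatrix_apply, monomialMatrix_apply, if_pos rfl] at h1
    by_cases h2 : π a = ρ a
    · rw [if_pos h2] at h1
      exact ⟨h2, h1⟩
    · rw [if_neg h2] at h1
      exact absurd h1 (hφ a)
  exact ⟨Equiv.ext fun a => (key a).1, funext fun a => (key a).2⟩

end Monomial

/-- The gate with matrix `σ.permMatrix ℂ`; it sends the basis state `σ a` to the basis state `a`. -/
def permGate {n : ℕ} (σ : Equiv.Perm (Fin n → ZMod 2)) : Gate n :=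
  ⟨monomialMatrix σ fun _ => 1, by
    rw [Matrix.mem_unitaryGroup_iff, star_monomialMatrix, monomialMatrix_mul]
    simpa using monomialMatrix_one_one⟩

theorem permGate_mul {n : ℕ} (σ τ : Equiv.Perm (Fin n → ZMod 2)) :
    permGate (σ * τ) = permGate τ * permGate σ := by
  apply Subtype.ext
  change monomialMatrix _ _ = monomialMatrix _ _ * monomialMatrix _ _
  rw [monomialMatrix_mul]
  simp

theorem permGate_inv {n : ℕ} (σ : Equiv.Perm (Fin n → ZMod 2)) :
    (permGate σ)⁻¹ = permGate σ⁻¹ := by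
  rw [inv_eq_iff_mul_eq_one, ← permGate_mul]
  apply Subtype.ext
  simpa [permGate] using monomialMatrix_one_one

/-! ### The Pauli group in monomial form -/

/-- The nontrivial character `t ↦ (-1)ᵗ` of `𝔽₂`. -/
def signChar : AddChar (ZMod 2) ℂ := AddChar.zmodChar 2 (ζ := -1) (by norm_num)

theorem signChar_zero : signChar 0 = 1 := AddChar.map_zero_eq_one _

theorem signChar_one : signChar 1 = -1 := by
  rw [signChar, AddChar.zmodChar_apply]
  simp [ZMod.val_one]

theorem signChar_dotProduct {n : ℕ} (w x : Fin n → ZMod 2) :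
    signChar (w ⬝ᵥ x) = ∏ j, signChar (w j * x j) := by
  have h := map_prod signChar.toMonoidHom (fun j => Multiplicative.ofAdd (w j * x j)) Finset.univ
  rw [← ofAdd_sum] at h
  exact h

theorem zmod_two_cases (t : ZMod 2) : t = 0 ∨ t = 1 := by
  revert t; decide

theorem signChar_ne_zero (t : ZMod 2) : signChar t ≠ 0 := by
  rcases zmod_two_cases t with rfl | rfl <;> norm_num [signChar_one]

theorem star_signChar (t : ZMod 2) : star (signChar t) = signChar t := by
  rcases zmod_two_cases t with rfl | rfl <;> norm_num [signChar_one]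

theorem signChar_mul_self (t : ZMod 2) : signChar t * signChar t = 1 := by
  rcases zmod_two_cases t with rfl | rfl <;> norm_num [signChar_one]

theorem signChar_pow_four (t : ZMod 2) : signChar t ^ 4 = 1 := by
  rcases zmod_two_cases t with rfl | rfl <;> norm_num [signChar_one]

theorem signChar_injective : Function.Injective signChar := by
  intro s t h
  rcases zmod_two_cases s with rfl | rfl <;> rcases zmod_two_cases t with rfl | rfl <;>
    first | rfl | (exfalso; rw [signChar_zero, signChar_one] at h; norm_num at h)

theorem pow_four_eq_one_iff (c : ℂ) :
    c ^ 4 = 1 ↔ c ∈ ({1, -1, Complex.I, -Complex.I} : Set ℂ) := by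
  have h : c ^ 4 - 1 = (c - 1) * (c + 1) * (c - Complex.I) * (c + Complex.I) := by
    linear_combination (c ^ 2 - 1) * Complex.I_sq
  rw [← sub_eq_zero, h]
  simp only [mul_eq_zero, sub_eq_zero, add_eq_zero_iff_eq_neg, Set.mem_insert_iff,
    Set.mem_singleton_iff, or_assoc]

theorem pow_four_ne_zero {c : ℂ} (hc : c ^ 4 = 1) : c ≠ 0 := by
  rintro rfl
  norm_num at hc

/-- The matrix `Z^w X^v` of a single qubit. -/
def localPauli (v w : ZMod 2) : Matrix (ZMod 2) (ZMod 2) ℂ :=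
  Matrix.of fun a b => if b = a + v then signChar (w * a) else 0

theorem localPauli_zero_zero : localPauli 0 0 = 1 := by
  ext a b
  simp [localPauli, Matrix.one_apply, eq_comm]

theorem localPauli_one_zero : localPauli 1 0 = pauliX := by
  ext a b
  rcases zmod_two_cases a with rfl | rfl <;> rcases zmod_two_cases b with rfl | rfl <;>
    simp [localPauli, pauliX, CharTwo.add_self_eq_zero] <;> rfl

theorem localPauli_zero_one : localPauli 0 1 = pauliZ := by
  ext a b
  rcases zmod_two_cases a with rfl | rfl <;> rcases zmod_two_cases b with rfl | rfl <;>
    simp [localPauli, pauliZ, signChar_one] <;> rfl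

theorem localPauli_one_one : (-Complex.I) • localPauli 1 1 = pauliY := by
  ext a b
  rcases zmod_two_cases a with rfl | rfl <;> rcases zmod_two_cases b with rfl | rfl <;>
    simp [localPauli, pauliY, signChar_one, CharTwo.add_self_eq_zero] <;> rfl

theorem tensorMatrix_localPauli {n : ℕ} (v w : Fin n → ZMod 2) :
    tensorMatrix (fun j => localPauli (v j) (w j)) =
      monomialMatrix (Equiv.addRight v) fun x => signChar (w ⬝ᵥ x) := by
  ext a b
  rw [monomialMatrix_apply]
  simp only [tensorMatrix, localPauli, Matrix.of_apply]
  by_cases h : b = Equiv.addRight v a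
  · rw [if_pos h, signChar_dotProduct]
    subst h
    exact Finset.prod_congr rfl fun j _ => if_pos rfl
  · rw [if_neg h]
    obtain ⟨j, hj⟩ := Function.ne_iff.1 h
    exact Finset.prod_eq_zero (Finset.mem_univ j) (if_neg hj)

theorem tensorMatrix_smul {n : ℕ} (c : Fin n → ℂ) (P : Fin n → Matrix (ZMod 2) (ZMod 2) ℂ) :
    tensorMatrix (fun j => c j • P j) = (∏ j, c j) • tensorMatrix P := by
  ext a b
  simp [tensorMatrix, Finset.prod_mul_distrib]

/-- The matrices of the Pauli gates: `c` times the monomial matrix that translates by `v` and carries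
the phases `(-1)^(w·x)`, where `c` is a fourth root of unity. -/
def IsPauliMatrix {n : ℕ} (A : Matrix (Fin n → ZMod 2) (Fin n → ZMod 2) ℂ) : Prop :=
  ∃ (v w : Fin n → ZMod 2) (c : ℂ), c ^ 4 = 1 ∧
    A = monomialMatrix (Equiv.addRight v) fun x => c * signChar (w ⬝ᵥ x)

theorem mem_pauliGroup_iff {n : ℕ} (U : Gate n) :
    U ∈ pauliGroup n ↔ IsPauliMatrix (U : Matrix (Fin n → ZMod 2) (Fin n → ZMod 2) ℂ) := by
  constructor
  · rintro ⟨c, hc, P, hP, hU⟩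
    have key : ∀ j, ∃ (v w : ZMod 2) (d : ℂ), d ^ 4 = 1 ∧ P j = d • localPauli v w := by
      intro j
      rcases hP j with h | h | h | h
      · exact ⟨0, 0, 1, by simp, by rw [h, localPauli_zero_zero, one_smul]⟩
      · exact ⟨1, 0, 1, by simp, by rw [h, localPauli_one_zero, one_smul]⟩
      · exact ⟨1, 1, -Complex.I, (pow_four_eq_one_iff _).2 (by simp),
          by rw [h, localPauli_one_one]⟩
      · exact ⟨0, 1, 1, by simp, by rw [h, localPauli_zero_one, one_smul]⟩
    choose v w d hd hPd using key
    refine ⟨v, w, c * ∏ j, d j, ?_, ?_⟩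
    · rw [mul_pow, (pow_four_eq_one_iff c).2 hc, ← Finset.prod_pow]
      simp [hd]
    · rw [hU, funext hPd, tensorMatrix_smul, tensorMatrix_localPauli, smul_smul,
        smul_monomialMatrix]
  · rintro ⟨v, w, c, hc, hU⟩
    have key : ∀ j, ∃ d : ℂ, d ^ 4 = 1 ∧ d • localPauli (v j) (w j) ∈
        ({1, pauliX, pauliY, pauliZ} : Set (Matrix (ZMod 2) (ZMod 2) ℂ)) := by
      intro j
      rcases zmod_two_cases (v j) with hv | hv <;> rcases zmod_two_cases (w j) with hw | hw <;>
        rw [hv, hw]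
      · exact ⟨1, by simp, by simp [localPauli_zero_zero]⟩
      · exact ⟨1, by simp, by simp [localPauli_zero_one]⟩
      · exact ⟨1, by simp, by simp [localPauli_one_zero]⟩
      · exact ⟨-Complex.I, (pow_four_eq_one_iff _).2 (by simp), by rw [localPauli_one_one]; simp⟩
    choose d hd hP using key
    have hd4 : (∏ j, d j) ^ 4 = 1 := by
      rw [← Finset.prod_pow]
      simp [hd]
    refine ⟨c * (∏ j, d j)⁻¹, (pow_four_eq_one_iff _).1 ?_, _, hP, ?_⟩
    · rw [mul_pow, inv_pow, hc, hd4, inv_one, one_mul]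
    · rw [hU, tensorMatrix_smul, tensorMatrix_localPauli, smul_smul,
        inv_mul_cancel_right₀ (pow_four_ne_zero hd4), smul_monomialMatrix]

theorem exists_dotProduct_of_affine {n : ℕ} (h : (Fin n → ZMod 2) → ZMod 2)
    (hh : ∀ x y, h (x + y) = h x + h y + h 0) :
    ∃ w : Fin n → ZMod 2, ∀ x, h x = w ⬝ᵥ x + h 0 := by
  let g : (Fin n → ZMod 2) →+ ZMod 2 :=
    { toFun := fun x => h x + h 0
      map_zero' := CharTwo.add_self_eq_zero _
      map_add' := fun x y => by
        rw [hh]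
        ring }
  refine ⟨fun j => g.toZModLinearMap 2 (Pi.single j 1), fun x => ?_⟩
  have h1 : g.toZModLinearMap 2 x = h x + h 0 := rfl
  have h2 := LinearMap.pi_apply_eq_sum_univ (g.toZModLinearMap 2) x
  have h3 : h x = (h x + h 0) + h 0 := by
    rw [add_assoc, CharTwo.add_self_eq_zero, add_zero]
  rw [h3, ← h1, h2]
  congr 1
  refine Finset.sum_congr rfl fun j _ => ?_
  have h4 : (fun k => if j = k then (1 : ZMod 2) else 0) = Pi.single j 1 := by
    ext k
    simp [Pi.single_apply, eq_comm]
  rw [h4, smul_eq_mul, mul_comm]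

theorem isPauliMatrix_of_affine {n : ℕ} (v : Fin n → ZMod 2) (c : ℂ) (hc : c ^ 4 = 1)
    (h : (Fin n → ZMod 2) → ZMod 2) (hh : ∀ x y, h (x + y) = h x + h y + h 0) :
    IsPauliMatrix (monomialMatrix (Equiv.addRight v) fun x => c * signChar (h x)) := by
  obtain ⟨w, hw⟩ := exists_dotProduct_of_affine h hh
  refine ⟨v, w, c * signChar (h 0), by rw [mul_pow, hc, signChar_pow_four, one_mul], ?_⟩
  congr 1
  funext x
  rw [hw x, AddChar.map_add_eq_mul]
  ring

/-- A monomial Pauli matrix permutes the basis states by a translation, and its phases are a character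
of `𝔽₂ⁿ` up to a constant. -/
theorem IsPauliMatrix.of_monomialMatrix {n : ℕ} {π : Equiv.Perm (Fin n → ZMod 2)}
    {φ : (Fin n → ZMod 2) → ℂ} (hφ : ∀ x, φ x ≠ 0) (h : IsPauliMatrix (monomialMatrix π φ)) :
    ∃ (v w : Fin n → ZMod 2) (c : ℂ), c ^ 4 = 1 ∧ (∀ x, π x = x + v) ∧
      ∀ x, φ x = c * signChar (w ⬝ᵥ x) := by
  obtain ⟨v, w, c, hc, h⟩ := h
  obtain ⟨rfl, rfl⟩ := monomialMatrix_inj hφ h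
  exact ⟨v, w, c, hc, fun x => rfl, fun x => rfl⟩

/-- The gate `X^v`. -/
def translationGate {n : ℕ} (v : Fin n → ZMod 2) : Gate n := permGate (Equiv.addRight v)

/-- The gate `Z^w`. -/
def phaseGate {n : ℕ} (w : Fin n → ZMod 2) : Gate n :=
  ⟨monomialMatrix 1 fun x => signChar (w ⬝ᵥ x), by
    rw [Matrix.mem_unitaryGroup_iff, star_monomialMatrix, monomialMatrix_mul]
    simpa [star_signChar, signChar_mul_self, -RCLike.star_def] using monomialMatrix_one_one⟩

theorem translationGate_mem_pauliGroup {n : ℕ} (v : Fin n → ZMod 2) :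
    translationGate v ∈ pauliGroup n :=
  (mem_pauliGroup_iff _).2 ⟨v, 0, 1, by simp, by simp [translationGate, permGate]⟩

theorem phaseGate_mem_pauliGroup {n : ℕ} (w : Fin n → ZMod 2) : phaseGate w ∈ pauliGroup n :=
  (mem_pauliGroup_iff _).2 ⟨0, w, 1, by simp, by simp [phaseGate]⟩

theorem phaseGate_isDiagonalGate {n : ℕ} (w : Fin n → ZMod 2) : IsDiagonalGate (phaseGate w) := by
  intro a b hab
  change monomialMatrix _ _ a b = 0
  rw [monomialMatrix_apply, if_neg (by simpa using hab.symm)]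

theorem IsDiagonalGate.commute {n : ℕ} {d e : Gate n} (hd : IsDiagonalGate d)
    (he : IsDiagonalGate e) : d * e = e * d := by
  apply Subtype.ext
  have hx := (Matrix.isDiag_iff_diagonal_diag _).1 hd
  have hy := (Matrix.isDiag_iff_diagonal_diag _).1 he
  change d.1 * e.1 = e.1 * d.1
  rw [← hx, ← hy, Matrix.diagonal_mul_diagonal, Matrix.diagonal_mul_diagonal]
  simp only [mul_comm]

theorem isDiagonalGate_of_commute_phaseGate {n : ℕ} {d : Gate n}
    (h : ∀ j, phaseGate (Pi.single j 1) * d = d * phaseGate (Pi.single j 1)) :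
    IsDiagonalGate d := by
  intro a b hab
  obtain ⟨j, hj⟩ := Function.ne_iff.1 hab
  have h1 : monomialMatrix 1 (fun x => signChar (Pi.single j 1 ⬝ᵥ x)) * d.1 =
      d.1 * monomialMatrix 1 (fun x => signChar (Pi.single j 1 ⬝ᵥ x)) :=
    congrArg Subtype.val (h j)
  have h2 := congrFun (congrFun h1 a) b
  rw [monomialMatrix_mul_apply] at h2
  have h3 := mul_monomialMatrix_apply 1 (fun x => signChar (Pi.single j 1 ⬝ᵥ x)) d.1 a b
  rw [Equiv.Perm.one_apply] at h2 h3
  rw [h3, mul_comm, mul_eq_mul_left_iff, single_one_dotProduct, single_one_dotProduct] at h2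
  rcases h2 with h2 | h2
  · exact absurd (signChar_injective h2) hj
  · exact h2

/-! ### Clifford gates -/

theorem mem_cliffordGroup_of_conj {n : ℕ} {U : Gate n}
    (h : ∀ P ∈ pauliGroup n, U * P * U⁻¹ ∈ pauliGroup n)
    (h' : ∀ P ∈ pauliGroup n, U⁻¹ * P * U ∈ pauliGroup n) : U ∈ cliffordGroup n := by
  refine Subgroup.mem_set_normalizer_iff.2 ?_
  refine fun P => ⟨h P, fun hP => ?_⟩
  have := h' _ hP
  simpa [mul_assoc] using this

theorem conj_mem_pauliGroup {n : ℕ} {U P : Gate n} (hU : U ∈ cliffordGroup n)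
    (hP : P ∈ pauliGroup n) : U * P * U⁻¹ ∈ pauliGroup n :=
  (Subgroup.mem_set_normalizer_iff.1 hU P).1 hP

theorem perm_apply_inv {α : Type*} (σ : Equiv.Perm α) (x : α) : σ (σ⁻¹ x) = x :=
  σ.apply_symm_apply x

theorem perm_inv_apply {α : Type*} (σ : Equiv.Perm α) (x : α) : σ⁻¹ (σ x) = x :=
  σ.symm_apply_apply x

theorem conj_addRight {n : ℕ} {σ : Equiv.Perm (Fin n → ZMod 2)}
    (h : ∀ x y, σ (x + y) = σ x + σ y + σ 0) (v : Fin n → ZMod 2) :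
    σ⁻¹ * Equiv.addRight v * σ = Equiv.addRight (σ⁻¹ (v + σ 0)) := by
  ext1 x
  change σ⁻¹ (σ x + v) = x + σ⁻¹ (v + σ 0)
  rw [Equiv.Perm.inv_eq_iff_eq, h, perm_apply_inv, add_assoc, add_assoc,
    ZModModule.add_self, add_zero]

theorem permGate_conj_mem_pauliGroup {n : ℕ} {σ : Equiv.Perm (Fin n → ZMod 2)}
    (h : ∀ x y, σ (x + y) = σ x + σ y + σ 0) {P : Gate n} (hP : P ∈ pauliGroup n) :
    permGate σ * P * (permGate σ)⁻¹ ∈ pauliGroup n := by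
  rw [mem_pauliGroup_iff] at hP ⊢
  obtain ⟨v, w, c, hc, hP⟩ := hP
  change IsPauliMatrix (monomialMatrix σ (fun _ => 1) * P.1 * star (monomialMatrix σ fun _ => 1))
  rw [hP, monomialMatrix_conj]
  have key := isPauliMatrix_of_affine (σ⁻¹ (v + σ 0)) c hc (fun x => w ⬝ᵥ σ x) (fun x y => by
    simp only [h x y, dotProduct_add])
  convert key using 2
  · exact conj_addRight h v
  · simp

theorem affine_symm {n : ℕ} {σ : Equiv.Perm (Fin n → ZMod 2)}
    (h : ∀ x y, σ (x + y) = σ x + σ y + σ 0) (x y : Fin n → ZMod 2) :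
    σ⁻¹ (x + y) = σ⁻¹ x + σ⁻¹ y + σ⁻¹ 0 := by
  rw [Equiv.Perm.inv_eq_iff_eq, h, h]
  rw [perm_apply_inv, perm_apply_inv, perm_apply_inv]
  rw [add_zero, add_assoc, ZModModule.add_self, add_zero]

theorem permGate_mem_cliffordGroup {n : ℕ} {σ : Equiv.Perm (Fin n → ZMod 2)}
    (h : ∀ x y, σ (x + y) = σ x + σ y + σ 0) : permGate σ ∈ cliffordGroup n := by
  refine mem_cliffordGroup_of_conj (fun P => permGate_conj_mem_pauliGroup h) fun P hP => ?_
  have := permGate_conj_mem_pauliGroup (affine_symm h) hP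
  rwa [← permGate_inv, inv_inv] at this

/-! ### Hadamard gates on a set of qubits -/

theorem tensorMatrix_mul {n : ℕ} (P Q : Fin n → Matrix (ZMod 2) (ZMod 2) ℂ) :
    tensorMatrix P * tensorMatrix Q = tensorMatrix fun j => P j * Q j := by
  ext a b
  simp only [Matrix.mul_apply, tensorMatrix, Matrix.of_apply, ← Finset.prod_mul_distrib]
  rw [Finset.prod_univ_sum, Fintype.piFinset_univ]

theorem star_tensorMatrix {n : ℕ} (P : Fin n → Matrix (ZMod 2) (ZMod 2) ℂ) :
    star (tensorMatrix P) = tensorMatrix fun j => star (P j) := by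
  ext a b
  simp [Matrix.star_apply, tensorMatrix]

theorem tensorMatrix_one {n : ℕ} :
    tensorMatrix (fun _ : Fin n => (1 : Matrix (ZMod 2) (ZMod 2) ℂ)) = 1 := by
  have h := tensorMatrix_localPauli (0 : Fin n → ZMod 2) 0
  simp only [Pi.zero_apply, localPauli_zero_zero] at h
  rw [h, ← monomialMatrix_one_one]
  congr 1
  · ext1 x
    exact add_zero x
  · simp

/-- The single-qubit Hadamard matrix. -/
noncomputable def hadamardMatrix : Matrix (ZMod 2) (ZMod 2) ℂ :=
  Matrix.of fun a b => ((Real.sqrt 2 : ℝ) : ℂ)⁻¹ * signChar (a * b)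

theorem star_hadamardMatrix : star hadamardMatrix = hadamardMatrix := by
  ext a b
  rw [Matrix.star_apply]
  simp only [hadamardMatrix, Matrix.of_apply, star_mul', star_signChar, mul_comm b a]
  simp

theorem sum_zmod_two (f : ZMod 2 → ℂ) : ∑ t, f t = f 0 + f 1 := Fin.sum_univ_two f

theorem inv_sqrt_two_mul_self :
    ((Real.sqrt 2 : ℝ) : ℂ)⁻¹ * ((Real.sqrt 2 : ℝ) : ℂ)⁻¹ = 1 / 2 := by
  rw [← mul_inv, ← Complex.ofReal_mul, Real.mul_self_sqrt (by norm_num)]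
  norm_num

theorem hadamardMatrix_conj_localPauli (v w : ZMod 2) :
    hadamardMatrix * localPauli v w * hadamardMatrix = signChar (v * w) • localPauli w v := by
  ext a b
  simp only [Matrix.mul_apply, sum_zmod_two, hadamardMatrix, localPauli, Matrix.of_apply,
    Matrix.smul_apply, smul_eq_mul]
  have h2 := inv_sqrt_two_mul_self
  generalize ((Real.sqrt 2 : ℝ) : ℂ)⁻¹ = r at h2 ⊢
  rcases zmod_two_cases v with rfl | rfl <;> rcases zmod_two_cases w with rfl | rfl <;>
    rcases zmod_two_cases a with rfl | rfl <;> rcases zmod_two_cases b with rfl | rfl <;>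
    simp [signChar_one, CharTwo.add_self_eq_zero] <;>
    first | linear_combination 2 * h2 | linear_combination -2 * h2

theorem hadamardMatrix_mul_self : hadamardMatrix * hadamardMatrix = 1 := by
  have h := hadamardMatrix_conj_localPauli 0 0
  simpa [localPauli_zero_zero] using h

/-- The tensor factors of the gate that applies a Hadamard gate to each qubit in `S`. -/
noncomputable def hadamardFactor {n : ℕ} (S : Finset (Fin n)) (j : Fin n) :
    Matrix (ZMod 2) (ZMod 2) ℂ :=
  if j ∈ S then hadamardMatrix else 1

/-- The gate that applies a Hadamard gate to each qubit in `S`. -/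
noncomputable def hadamardGate {n : ℕ} (S : Finset (Fin n)) : Gate n :=
  ⟨tensorMatrix (hadamardFactor S), by
    rw [Matrix.mem_unitaryGroup_iff, star_tensorMatrix, tensorMatrix_mul, ← tensorMatrix_one]
    congr 1
    funext j
    by_cases h : j ∈ S <;>
      simp [hadamardFactor, h, star_hadamardMatrix, hadamardMatrix_mul_self]⟩

theorem hadamardGate_mul_self {n : ℕ} (S : Finset (Fin n)) :
    hadamardGate S * hadamardGate S = 1 := by
  apply Subtype.ext
  change tensorMatrix _ * tensorMatrix _ = 1
  rw [tensorMatrix_mul, ← tensorMatrix_one]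
  congr 1
  funext j
  by_cases h : j ∈ S <;> simp [hadamardFactor, h, hadamardMatrix_mul_self]

theorem hadamardGate_inv {n : ℕ} (S : Finset (Fin n)) : (hadamardGate S)⁻¹ = hadamardGate S :=
  inv_eq_of_mul_eq_one_left (hadamardGate_mul_self S)

/-- On the qubits in `S`, a Hadamard gate exchanges `X` and `Z`. -/
theorem hadamardGate_conj {n : ℕ} (S : Finset (Fin n)) (v w : Fin n → ZMod 2) :
    tensorMatrix (hadamardFactor S) *
        monomialMatrix (Equiv.addRight v) (fun x => signChar (w ⬝ᵥ x)) *
        tensorMatrix (hadamardFactor S) =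
      (∏ j, if j ∈ S then signChar (v j * w j) else 1) •
        monomialMatrix (Equiv.addRight (S.piecewise w v))
          fun x => signChar (S.piecewise v w ⬝ᵥ x) := by
  rw [← tensorMatrix_localPauli, ← tensorMatrix_localPauli, tensorMatrix_mul, tensorMatrix_mul,
    ← tensorMatrix_smul]
  congr 1
  funext j
  by_cases h : j ∈ S <;> simp [hadamardFactor, h, hadamardMatrix_conj_localPauli]

theorem hadamardGate_mem_cliffordGroup {n : ℕ} (S : Finset (Fin n)) :
    hadamardGate S ∈ cliffordGroup n := by
  have key : ∀ P ∈ pauliGroup n, hadamardGate S * P * hadamardGate S ∈ pauliGroup n := by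
    intro P hP
    rw [mem_pauliGroup_iff] at hP ⊢
    obtain ⟨v, w, c, hc, hP⟩ := hP
    refine ⟨S.piecewise w v, S.piecewise v w,
      c * ∏ j, if j ∈ S then signChar (v j * w j) else 1, ?_, ?_⟩
    · rw [mul_pow, hc, one_mul, ← Finset.prod_pow]
      refine Finset.prod_eq_one fun j _ => ?_
      split_ifs
      · exact signChar_pow_four _
      · exact one_pow 4
    · change tensorMatrix _ * P.1 * tensorMatrix _ = _
      rw [hP, ← smul_monomialMatrix, Matrix.mul_smul, Matrix.smul_mul, hadamardGate_conj,
        smul_smul, smul_monomialMatrix]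
  exact mem_cliffordGroup_of_conj (by rwa [hadamardGate_inv]) (by rwa [hadamardGate_inv])

theorem hadamardGate_conj_phaseGate_of_mem {n : ℕ} {S : Finset (Fin n)} {j : Fin n} (hj : j ∈ S) :
    hadamardGate S * phaseGate (Pi.single j 1) * hadamardGate S =
      translationGate (Pi.single j 1) := by
  apply Subtype.ext
  have h := hadamardGate_conj S 0 (Pi.single j 1)
  have h1 : S.piecewise (Pi.single j 1) (0 : Fin n → ZMod 2) = Pi.single j 1 := by
    ext k
    by_cases hk : k = j
    · subst hk; simp [hj]
    · simp [Finset.piecewise, hk]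
  have h2 : S.piecewise (0 : Fin n → ZMod 2) (Pi.single j 1) = 0 := by
    ext k
    by_cases hk : k = j
    · subst hk; simp [hj]
    · simp [Finset.piecewise, hk]
  rw [h1, h2] at h
  simpa [hadamardGate, phaseGate, translationGate, permGate] using h

theorem hadamardGate_conj_phaseGate_of_notMem {n : ℕ} {S : Finset (Fin n)} {j : Fin n}
    (hj : j ∉ S) :
    hadamardGate S * phaseGate (Pi.single j 1) * hadamardGate S = phaseGate (Pi.single j 1) := by
  apply Subtype.ext
  have h := hadamardGate_conj S 0 (Pi.single j 1)
  have h1 : S.piecewise (Pi.single j 1) (0 : Fin n → ZMod 2) = 0 := by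
    ext k
    by_cases hk : k = j
    · subst hk; simp [hj]
    · simp [Finset.piecewise, hk]
  have h2 : S.piecewise (0 : Fin n → ZMod 2) (Pi.single j 1) = Pi.single j 1 := by
    ext k
    by_cases hk : k = j
    · subst hk; simp [hj]
    · simp [Finset.piecewise, hk]
  rw [h1, h2] at h
  simpa [hadamardGate, phaseGate] using h

/-! ### Semi-Clifford permutation gates -/

theorem IsSemiClifford.mul {n : ℕ} {U φ₁ φ₂ : Gate n} (hU : IsSemiClifford U)
    (h₁ : φ₁ ∈ cliffordGroup n) (h₂ : φ₂ ∈ cliffordGroup n) : IsSemiClifford (φ₁ * U * φ₂) := by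
  obtain ⟨ψ₁, hψ₁, ψ₂, hψ₂, d, hd, rfl⟩ := hU
  exact ⟨φ₁ * ψ₁, mul_mem h₁ hψ₁, ψ₂ * φ₂, mul_mem hψ₂ h₂, d, hd, by simp only [mul_assoc]⟩

/-- A permutation that fixes the coordinates outside `S` and commutes with the translations along the
coordinates in `S` becomes diagonal when conjugated by Hadamard gates on `S`. -/
theorem isSemiClifford_permGate_of_shear {n : ℕ} (S : Finset (Fin n))
    {σ : Equiv.Perm (Fin n → ZMod 2)} (hS : ∀ j ∉ S, ∀ x, σ x j = x j)
    (hT : ∀ j ∈ S, ∀ x, σ (x + Pi.single j 1) = σ x + Pi.single j 1) :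
    IsSemiClifford (permGate σ) := by
  have hH := hadamardGate_mul_self S
  have hHH : ∀ A : Gate n, hadamardGate S * (hadamardGate S * A) = A := fun A => by
    rw [← mul_assoc, hH, one_mul]
  refine ⟨hadamardGate S, hadamardGate_mem_cliffordGroup S, hadamardGate S,
    hadamardGate_mem_cliffordGroup S, hadamardGate S * permGate σ * hadamardGate S, ?_, by
      simp only [mul_assoc, hHH, hH, mul_one]⟩
  apply isDiagonalGate_of_commute_phaseGate
  intro j
  have key : hadamardGate S * phaseGate (Pi.single j 1) * hadamardGate S * permGate σ =
      permGate σ * (hadamardGate S * phaseGate (Pi.single j 1) * hadamardGate S) := by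
    by_cases hj : j ∈ S
    · rw [hadamardGate_conj_phaseGate_of_mem hj, translationGate, ← permGate_mul, ← permGate_mul]
      congr 1
      ext1 x
      exact hT j hj x
    · rw [hadamardGate_conj_phaseGate_of_notMem hj]
      apply Subtype.ext
      change monomialMatrix _ _ * monomialMatrix _ _ = monomialMatrix _ _ * monomialMatrix _ _
      rw [monomialMatrix_mul, monomialMatrix_mul, one_mul, mul_one]
      congr 1
      funext x
      simp [hS j hj]
  have := congrArg (fun A => hadamardGate S * A * hadamardGate S) key
  simpa only [mul_assoc, hHH, hH, mul_one] using this

/-! ### Square-zero commutative algebras over `𝔽₂` -/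

/-- In a commutative associative `𝔽₂`-algebra in which all squares vanish, a nonzero product `xyz` makes
`x, y, z, xy, xz, yz, xyz` linearly independent. -/
theorem seven_le_finrank_of_mul_mul_ne_zero {V : Type*} [AddCommGroup V] [Module (ZMod 2) V]
    [Module.Finite (ZMod 2) V] (m : V →+ V →+ V) (comm : ∀ x y, m x y = m y x)
    (assoc : ∀ x y z, m (m x y) z = m x (m y z)) (sq : ∀ x, m x x = 0) {x y z : V}
    (h : m (m x y) z ≠ 0) : 7 ≤ Module.finrank (ZMod 2) V := by
  have left : ∀ a b c, m a (m b c) = m b (m a c) := fun a b c => by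
    rw [← assoc, comm a b, assoc]
  have sq' : ∀ a b, m a (m a b) = 0 := fun a b => by rw [← assoc, sq]; simp
  have h' : m x (m y z) ≠ 0 := by rwa [← assoc]
  have smul : ∀ (a : V) (c : ZMod 2) (b : V), m a (c • b) = c • m a b :=
    fun a c b => ZMod.map_smul (m a) c b
  have hyx : m y x = m x y := comm _ _
  have hzx : m z x = m x z := comm _ _
  have hzy : m z y = m y z := comm _ _
  have lin : LinearIndependent (ZMod 2)
      ![x, y, z, m x y, m x z, m y z, m x (m y z)] := by
    rw [Fintype.linearIndependent_iff]
    intro g hg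
    simp only [Fin.sum_univ_seven, Matrix.cons_val] at hg
    -- Multiplying by the product of the complementary generators isolates one coefficient.
    have h0 : g 0 = 0 := by
      have := congrArg (m (m y z)) hg
      simpa [smul, assoc, sq, sq', left y, left z, hyx, hzx, hzy, h'] using this
    have h1 : g 1 = 0 := by
      have := congrArg (m (m x z)) hg
      simpa [smul, assoc, sq, sq', left y, left z, hyx, hzx, hzy, h', h0] using this
    have h2 : g 2 = 0 := by
      have := congrArg (m (m x y)) hg
      simpa [smul, assoc, sq, sq', left y, left z, hyx, hzx, hzy, h', h0, h1] using this
    have h3 : g 3 = 0 := by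
      have := congrArg (m z) hg
      simpa [smul, assoc, sq, sq', left y, left z, hyx, hzx, hzy, h', h0, h1, h2] using this
    have h4 : g 4 = 0 := by
      have := congrArg (m y) hg
      simpa [smul, assoc, sq, sq', left y, left z, hyx, hzx, hzy, h', h0, h1, h2, h3] using this
    have h5 : g 5 = 0 := by
      have := congrArg (m x) hg
      simpa [smul, assoc, sq, sq', left y, left z, hyx, hzx, hzy, h', h0, h1, h2, h3, h4]
        using this
    have h6 : g 6 = 0 := by simpa [h0, h1, h2, h3, h4, h5, h'] using hg
    intro i
    fin_cases i <;> assumption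
  simpa using lin.fintype_card_le_finrank

section CircleProduct

variable {V : Type*} [AddCommGroup V] [Module (ZMod 2) V]

/-- The product `xy = x ∘ y + x + y` of the group law `x ∘ y = f⁻¹(f x + f y)`. It is biadditive because
every `x ↦ f⁻¹(f x + v)` is affine. -/
def circleProduct (f : Equiv.Perm V)
    (hf : ∀ v x y, f⁻¹ (f (x + y) + v) = f⁻¹ (f x + v) + f⁻¹ (f y + v) + f⁻¹ (f 0 + v))
    (f0 : f 0 = 0) : V →+ V →+ V :=
  have add : ∀ x y z, f⁻¹ (f (x + y) + f z) + (x + y) + z =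
      (f⁻¹ (f x + f z) + x + z) + (f⁻¹ (f y + f z) + y + z) := fun x y z => by
    have hz : z + z = 0 := ZModModule.add_self z
    rw [hf, f0, zero_add, perm_inv_apply]
    abel_nf
  AddMonoidHom.mk'
    (fun x => AddMonoidHom.mk' (fun y => f⁻¹ (f x + f y) + x + y) fun y z => by
      rw [add_comm (f x) (f (y + z)), add_comm (f x) (f y), add_comm (f x) (f z)]
      rw [add_right_comm _ x (y + z), add_right_comm _ x y, add_right_comm _ x z]
      exact add y z x)
    fun x y => by
      ext z
      exact add x y z

variable {f : Equiv.Perm V}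
    {hf : ∀ v x y, f⁻¹ (f (x + y) + v) = f⁻¹ (f x + v) + f⁻¹ (f y + v) + f⁻¹ (f 0 + v)}
    {f0 : f 0 = 0}

theorem circleProduct_apply (x y : V) :
    circleProduct f hf f0 x y = f⁻¹ (f x + f y) + x + y := rfl

theorem apply_add_add_circleProduct (x y : V) :
    f (x + y + circleProduct f hf f0 x y) = f x + f y := by
  have h : x + y + circleProduct f hf f0 x y = f⁻¹ (f x + f y) := by
    rw [circleProduct_apply]
    have hx : x + x = 0 := ZModModule.add_self x
    have hy : y + y = 0 := ZModModule.add_self y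
    calc x + y + (f⁻¹ (f x + f y) + x + y) = f⁻¹ (f x + f y) + (x + x) + (y + y) := by abel
      _ = f⁻¹ (f x + f y) := by rw [hx, hy, add_zero, add_zero]
  rw [h, perm_apply_inv]

theorem circleProduct_comm (x y : V) : circleProduct f hf f0 x y = circleProduct f hf f0 y x := by
  rw [circleProduct_apply, circleProduct_apply, add_comm (f x), add_right_comm]

theorem circleProduct_self (x : V) : circleProduct f hf f0 x x = 0 := by
  rw [circleProduct_apply, ZModModule.add_self, add_assoc, ZModModule.add_self, add_zero,
    Equiv.Perm.inv_eq_iff_eq, f0]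

theorem circleProduct_assoc (x y z : V) :
    circleProduct f hf f0 (circleProduct f hf f0 x y) z =
      circleProduct f hf f0 x (circleProduct f hf f0 y z) := by
  have h1 := (apply_add_add_circleProduct (hf := hf) (f0 := f0)
    (x + y + circleProduct f hf f0 x y) z).trans
      (congrArg (· + f z) (apply_add_add_circleProduct x y))
  have h2 := (apply_add_add_circleProduct (hf := hf) (f0 := f0)
    x (y + z + circleProduct f hf f0 y z)).trans
      (congrArg (f x + ·) (apply_add_add_circleProduct y z))
  have h3 := f.injective (h1.trans ((add_assoc _ _ _).trans h2.symm))
  simp only [map_add, AddMonoidHom.add_apply] at h3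
  refine add_left_cancel (a := x + y + z + circleProduct f hf f0 x y + circleProduct f hf f0 x z +
    circleProduct f hf f0 y z) ?_
  calc _ = _ := by abel
    _ = _ := h3
    _ = _ := by abel

end CircleProduct

/-! ### Shears -/

/-- Every subspace of `𝔽₂ⁿ` is a coordinate subspace in suitable coordinates. -/
theorem exists_linearEquiv_mem_iff {n : ℕ} (W : Submodule (ZMod 2) (Fin n → ZMod 2)) :
    ∃ (E : (Fin n → ZMod 2) ≃ₗ[ZMod 2] (Fin n → ZMod 2)) (S : Finset (Fin n)),
      ∀ x, E x ∈ W ↔ ∀ j ∉ S, x j = 0 := by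
  obtain ⟨C, hC⟩ := W.exists_isCompl
  let b := ((Module.finBasis (ZMod 2) W).prod (Module.finBasis (ZMod 2) C)).map
    (W.prodEquivOfIsCompl C hC)
  have hcard : Fintype.card (Fin (Module.finrank (ZMod 2) W) ⊕ Fin (Module.finrank (ZMod 2) C)) =
      Fintype.card (Fin n) := by
    rw [← Module.finrank_eq_card_basis b]
    simp
  let e := Fintype.equivOfCardEq hcard
  let b' := b.reindex e
  refine ⟨b'.equivFun.symm, Finset.univ.filter fun j => (e.symm j).isLeft, fun x => ?_⟩
  refine (Submodule.prodEquivOfIsCompl_symm_apply_snd_eq_zero _ _ hC).symm.trans ?_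
  rw [← (Module.finBasis (ZMod 2) C).repr.map_eq_zero_iff]
  have hx : ∀ i, (Module.finBasis (ZMod 2) C).repr
      ((W.prodEquivOfIsCompl C hC).symm (b'.equivFun.symm x)).2 i = x (e (Sum.inr i)) := by
    intro i
    have h2 := congrFun (b'.equivFun.apply_symm_apply x) (e (Sum.inr i))
    rw [Module.Basis.equivFun_apply] at h2
    rw [← h2]
    generalize b'.equivFun.symm x = z
    simp only [b', Module.Basis.repr_reindex_apply, Equiv.symm_apply_apply]
    exact (Module.Basis.prod_repr_inr _ _ _ _).symm
  constructor
  · intro h j hj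
    cases hi : e.symm j with
    | inl i => simp [hi] at hj
    | inr i =>
      have hji : j = e (Sum.inr i) := by rw [← hi, Equiv.apply_symm_apply]
      rw [hji, ← hx i, h]
      rfl
  · intro h
    ext i
    rw [hx i]
    exact h _ (by simp)

/-- A permutation that is additive modulo the image of a subspace `W` and additive along `W` is, up to
linear maps on both sides, a shear. -/
theorem exists_linearEquiv_shear {n : ℕ} (f : Equiv.Perm (Fin n → ZMod 2)) (f0 : f 0 = 0)
    (W : Submodule (ZMod 2) (Fin n → ZMod 2))
    (hW : ∀ x, ∀ a ∈ W, f (x + a) = f x + f a)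
    (hmod : ∀ x y, ∃ a ∈ W, f (x + y) = f x + f y + f a) :
    ∃ (E G : (Fin n → ZMod 2) ≃ₗ[ZMod 2] (Fin n → ZMod 2)) (S : Finset (Fin n)),
      (∀ j ∉ S, ∀ x, G.symm (f (E x)) j = x j) ∧
      ∀ j ∈ S, ∀ x, G.symm (f (E (x + Pi.single j 1))) =
        G.symm (f (E x)) + Pi.single j 1 := by
  obtain ⟨E, S, hE⟩ := exists_linearEquiv_mem_iff W
  let b : Fin n → (Fin n → ZMod 2) := fun j => E (Pi.single j 1)
  -- `G₀` sends the standard basis to the images under `f` of a basis `b` adapted to `W`.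
  let G₀ : (Fin n → ZMod 2) →ₗ[ZMod 2] (Fin n → ZMod 2) :=
    Fintype.linearCombination (ZMod 2) fun j => f (b j)
  have hG₀ : ∀ x, G₀ x = ∑ j, x j • f (b j) := fun x => rfl
  have hEx : ∀ x, E x = ∑ j, x j • b j := fun x => by
    conv_lhs => rw [pi_eq_sum_univ' x]
    rw [map_sum]
    refine Finset.sum_congr rfl fun j _ => ?_
    rw [map_smul]
  have hsmul : ∀ (c : ZMod 2) x, f (c • x) = c • f x := fun c x => by
    rcases zmod_two_cases c with rfl | rfl <;> simp [f0]
  have hmodG : ∀ x, ∃ a ∈ W, f (E x) = G₀ x + f a := by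
    intro x
    rw [hEx, hG₀]
    induction (Finset.univ : Finset (Fin n)) using Finset.induction_on with
    | empty => exact ⟨0, W.zero_mem, by simp [f0]⟩
    | insert j s hj ih =>
      obtain ⟨a, ha, h⟩ := ih
      obtain ⟨a', ha', h'⟩ := hmod (x j • b j) (∑ j ∈ s, x j • b j)
      refine ⟨a + a', W.add_mem ha ha', ?_⟩
      rw [Finset.sum_insert hj, Finset.sum_insert hj, h', h, hsmul, hW a a' ha']
      abel
  have hGW : ∀ x, E x ∈ W → f (E x) = G₀ x := by
    intro x hx
    have hb : ∀ j, x j • b j ∈ W := fun j => by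
      by_cases hj : j ∈ S
      · refine W.smul_mem _ ((hE _).2 fun k hk => ?_)
        rw [Pi.single_eq_of_ne (by rintro rfl; exact hk hj)]
      · rw [(hE x).1 hx j hj, zero_smul]
        exact W.zero_mem
    rw [hEx, hG₀]
    induction (Finset.univ : Finset (Fin n)) using Finset.induction_on with
    | empty => simp [f0]
    | insert j s hj ih =>
      rw [Finset.sum_insert hj, Finset.sum_insert hj, add_comm, hW _ _ (hb j), ih, hsmul,
        add_comm]
  have hinj : Function.Injective G₀ := by
    rw [injective_iff_map_eq_zero]
    intro x hx
    obtain ⟨a, ha, h⟩ := hmodG x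
    rw [hx, zero_add] at h
    have hxW : E x ∈ W := by rwa [f.injective h]
    have h2 := hGW x hxW
    rw [hx, ← f0] at h2
    exact E.map_eq_zero_iff.1 (f.injective h2)
  let G := LinearEquiv.ofInjectiveEndo G₀ hinj
  have hG : ∀ x, G x = G₀ x := fun x => rfl
  refine ⟨E, G, S, fun j hj x => ?_, fun j hj x => ?_⟩
  -- Modulo `f W`, which `G.symm` maps to the vectors supported on `S`, `f (E x)` equals `G x`.
  · obtain ⟨a, ha, h⟩ := hmodG x
    obtain ⟨y, rfl⟩ := E.surjective a
    rw [hGW y ha, ← map_add, ← hG] at h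
    rw [h, LinearEquiv.symm_apply_apply, Pi.add_apply, (hE y).1 ha j hj, add_zero]
  · have hbW : b j ∈ W := (hE _).2 fun k hk => by
      rw [Pi.single_eq_of_ne (by rintro rfl; exact hk hj)]
    have h : f (b j) = G (Pi.single j 1) := by rw [hG, ← hGW _ hbW]
    rw [map_add, hW _ _ hbW, h, map_add, LinearEquiv.symm_apply_apply]

/-- A permutation gate of the third level on at most six qubits is a shear up to affine maps, because
the product `xyz` of its circle algebra vanishes for dimension reasons. -/
theorem isSemiClifford_permGate_of_affine {n : ℕ} (hn : n ≤ 6) (f : Equiv.Perm (Fin n → ZMod 2))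
    (hf : ∀ v x y, f⁻¹ (f (x + y) + v) = f⁻¹ (f x + v) + f⁻¹ (f y + v) + f⁻¹ (f 0 + v))
    (f0 : f 0 = 0) : IsSemiClifford (permGate f) := by
  let m := circleProduct f hf f0
  have hm : ∀ x y, f (x + y + m x y) = f x + f y := apply_add_add_circleProduct
  have hxyz : ∀ x y z, m (m x y) z = 0 := by
    intro x y z
    by_contra h
    have := seven_le_finrank_of_mul_mul_ne_zero m circleProduct_comm circleProduct_assoc
      circleProduct_self h
    rw [Module.finrank_fin_fun] at this
    omega
  -- `W` is the annihilator of the algebra; along it the two group laws agree.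
  let W := LinearMap.ker (m.toZModLinearMap 2)
  have hW' : ∀ a, a ∈ W ↔ m a = 0 := fun a => Iff.rfl
  have hW : ∀ x, ∀ a ∈ W, f (x + a) = f x + f a := fun x a ha => by
    have h := hm x a
    rwa [show m x a = 0 by rw [show m x a = m a x from circleProduct_comm x a, (hW' a).1 ha]; rfl,
      add_zero] at h
  have hmod : ∀ x y, ∃ a ∈ W, f (x + y) = f x + f y + f a := fun x y => by
    have hxy : m x y ∈ W := (hW' _).2 (AddMonoidHom.ext fun z => hxyz x y z)
    refine ⟨m x y, hxy, ?_⟩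
    rw [← hm, hW _ _ hxy, add_assoc, ZModModule.add_self, add_zero]
  obtain ⟨E, G, S, h1, h2⟩ := exists_linearEquiv_shear f f0 W hW hmod
  let σ : Equiv.Perm (Fin n → ZMod 2) := (E.toEquiv.trans f).trans G.symm.toEquiv
  have hσ : IsSemiClifford (permGate σ) := isSemiClifford_permGate_of_shear S h1 h2
  have hfσ : f = G.toEquiv * (σ * E.symm.toEquiv) := by
    ext1 x
    simp [σ]
  have hlin : ∀ L : (Fin n → ZMod 2) ≃ₗ[ZMod 2] (Fin n → ZMod 2),
      permGate L.toEquiv ∈ cliffordGroup n := fun L =>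
    permGate_mem_cliffordGroup fun x y => by simp
  rw [hfσ, permGate_mul, permGate_mul]
  exact hσ.mul (hlin E.symm) (hlin G)

/-- For a third-level permutation gate, `x ↦ f⁻¹(f x + v)` is affine: it is the permutation of the
Clifford gate obtained by conjugating `X^v`. -/
theorem affine_of_mem_cliffordHierarchy_three {n : ℕ} {f : Equiv.Perm (Fin n → ZMod 2)}
    (h : permGate f ∈ cliffordHierarchy n 3) (v x y : Fin n → ZMod 2) :
    f⁻¹ (f (x + y) + v) = f⁻¹ (f x + v) + f⁻¹ (f y + v) + f⁻¹ (f 0 + v) := by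
  let π := f⁻¹ * Equiv.addRight v * f
  have hπx : ∀ x, π x = f⁻¹ (f x + v) := fun x => rfl
  have hππ : ∀ x, π (π x) = x := fun x => by
    rw [hπx, hπx, perm_apply_inv, add_assoc, ZModModule.add_self, add_zero, perm_inv_apply]
  have hπ : permGate f * translationGate v * (permGate f)⁻¹ = permGate π := by
    rw [permGate_inv, translationGate, ← permGate_mul, ← permGate_mul, ← mul_assoc]
  -- `π` normalizes the translations, as `permGate π` conjugates each `X^w` to a Pauli gate.
  have key : ∀ w, ∃ w', ∀ x, π (x + w) = π x + w' := by
    intro w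
    have h1 : permGate f * translationGate v * (permGate f)⁻¹ * translationGate w *
        (permGate f * translationGate v * (permGate f)⁻¹)⁻¹ ∈ pauliGroup n :=
      h _ (translationGate_mem_pauliGroup v) _ (translationGate_mem_pauliGroup w)
    rw [hπ, permGate_inv, translationGate, ← permGate_mul, ← permGate_mul, mem_pauliGroup_iff] at h1
    obtain ⟨w', -, -, -, h2, -⟩ := IsPauliMatrix.of_monomialMatrix (fun _ => one_ne_zero) h1
    refine ⟨w', fun x => ?_⟩
    have h3 := h2 (π x)
    rw [← h3]
    change _ = π⁻¹ (π (π x) + w)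
    rw [hππ, eq_comm, Equiv.Perm.inv_eq_iff_eq, hππ]
  obtain ⟨w', hw⟩ := key y
  have h0 := hw 0
  rw [zero_add] at h0
  change π (x + y) = π x + π y + π 0
  rw [hw, h0, add_assoc, add_right_comm, ZModModule.add_self, zero_add]

theorem IsPermutationGate.exists_eq_permGate {n : ℕ} {U : Gate n} (hU : IsPermutationGate U) :
    ∃ σ, U = permGate σ := by
  obtain ⟨σ, hσ⟩ := hU
  exact ⟨σ, Subtype.ext (hσ.trans (permMatrix_eq_monomialMatrix σ))⟩

theorem isSemiClifford_of_le_six {n : ℕ} (hn : n ≤ 6) {U : Gate n} (hU : IsPermutationGate U)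
    (h3 : U ∈ cliffordHierarchy n 3) : IsSemiClifford U := by
  obtain ⟨f, rfl⟩ := hU.exists_eq_permGate
  have hf := affine_of_mem_cliffordHierarchy_three h3
  let g := Equiv.addRight (f 0) * f
  have hfg : f = Equiv.addRight (f 0) * g := by
    ext1 x
    change f x = f x + f 0 + f 0
    rw [add_assoc, ZModModule.add_self, add_zero]
  have hg : ∀ v x, g⁻¹ (g x + v) = f⁻¹ (f x + v) := fun v x => by
    rw [Equiv.Perm.inv_eq_iff_eq]
    change f x + f 0 + v = f (f⁻¹ (f x + v)) + f 0
    rw [perm_apply_inv, add_right_comm]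
  have hsemi : IsSemiClifford (permGate g) :=
    isSemiClifford_permGate_of_affine hn g (fun v x y => by simp only [hg, hf v x y])
      (ZModModule.add_self (f 0))
  have htr : permGate (Equiv.addRight (f 0)) ∈ cliffordGroup n :=
    permGate_mem_cliffordGroup fun x y => by
      change x + y + f 0 = x + f 0 + (y + f 0) + (0 + f 0)
      rw [zero_add, add_add_add_comm, add_assoc (x + y), ← add_assoc (x + y), add_assoc (x + y),
        ZModModule.add_self, zero_add]
  have := hsemi.mul (one_mem (cliffordGroup n)) htr
  rwa [one_mul, ← permGate_mul, ← hfg] at this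

/-! ### An obstruction to being semi-Clifford -/

/-- If `v` is a second difference of `f`, then `X^v` commutes with every Pauli gate that `permGate f`
conjugates to a Pauli gate. For a semi-Clifford gate these Pauli gates include a maximal commuting set,
which then contains `X^v` up to a scalar; so `permGate f` conjugates `X^v` to a Pauli gate. -/
theorem exists_translation_of_isSemiClifford {n : ℕ} {f : Equiv.Perm (Fin n → ZMod 2)}
    (hf : IsSemiClifford (permGate f)) (a b : Fin n → ZMod 2) :
    ∃ t, ∀ x, f⁻¹ (f x + (f (a + b) + f a + f b + f 0)) = x + t := by
  obtain ⟨φ₁, h₁, φ₂, h₂, d, hd, hU⟩ := hf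
  generalize hv : f (a + b) + f a + f b + f 0 = v
  have hconj : ∀ e : Gate n, IsDiagonalGate e →
      permGate f * (φ₂⁻¹ * e * φ₂) * (permGate f)⁻¹ = φ₁ * e * φ₁⁻¹ := by
    intro e he
    rw [hU]
    calc φ₁ * d * φ₂ * (φ₂⁻¹ * e * φ₂) * (φ₁ * d * φ₂)⁻¹ = φ₁ * (d * e) * d⁻¹ * φ₁⁻¹ := by group
      _ = φ₁ * e * φ₁⁻¹ := by rw [hd.commute he]; group
  have h₂' : ∀ P ∈ pauliGroup n, φ₂⁻¹ * P * φ₂ ∈ pauliGroup n := fun P hP => by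
    simpa using conj_mem_pauliGroup (inv_mem h₂) hP
  -- `X^v` commutes with the preimages of the gates `Z^w`.
  have hcomm : ∀ w, translationGate v * (φ₂⁻¹ * phaseGate w * φ₂) =
      (φ₂⁻¹ * phaseGate w * φ₂) * translationGate v := by
    intro w
    have hQ := h₂' _ (phaseGate_mem_pauliGroup w)
    have hR : permGate f * (φ₂⁻¹ * phaseGate w * φ₂) * (permGate f)⁻¹ ∈ pauliGroup n := by
      rw [hconj _ (phaseGate_isDiagonalGate w)]
      exact conj_mem_pauliGroup h₁ (phaseGate_mem_pauliGroup w)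
    generalize φ₂⁻¹ * phaseGate w * φ₂ = Q at hQ hR ⊢
    rw [mem_pauliGroup_iff] at hQ hR
    obtain ⟨v', u, c, hc, hQ⟩ := hQ
    change IsPauliMatrix (monomialMatrix f (fun _ => 1) * Q.1 * star (monomialMatrix f fun _ => 1))
      at hR
    rw [hQ, monomialMatrix_conj] at hR
    simp only [one_mul, star_one, mul_one] at hR
    obtain ⟨-, u', c', -, -, hu⟩ := IsPauliMatrix.of_monomialMatrix
      (fun x => mul_ne_zero (pow_four_ne_zero hc) (signChar_ne_zero _)) hR
    have hc0 := pow_four_ne_zero hc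
    -- The phases of the conjugate form a character, whose second differences are trivial.
    have huv : signChar (u ⬝ᵥ v) = 1 := by
      have e1 := hu (a + b)
      have e2 := hu a
      have e3 := hu b
      have e4 := hu 0
      rw [dotProduct_add, AddChar.map_add_eq_mul] at e1
      rw [dotProduct_zero, AddChar.map_zero_eq_one, mul_one] at e4
      have s2 := signChar_mul_self (u' ⬝ᵥ a)
      have s3 := signChar_mul_self (u' ⬝ᵥ b)
      have s0 := signChar_mul_self (u ⬝ᵥ f 0)
      rw [← hv]
      simp only [dotProduct_add, AddChar.map_add_eq_mul]
      apply mul_left_cancel₀ (pow_ne_zero 4 hc0)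
      have hc4 : c' ^ 4 = c ^ 4 := by
        rw [← e4, mul_pow, signChar_pow_four, mul_one]
      calc c ^ 4 * (signChar (u ⬝ᵥ f (a + b)) * signChar (u ⬝ᵥ f a) * signChar (u ⬝ᵥ f b) *
            signChar (u ⬝ᵥ f 0))
          = (c * signChar (u ⬝ᵥ f (a + b))) * (c * signChar (u ⬝ᵥ f a)) *
            (c * signChar (u ⬝ᵥ f b)) * (c * signChar (u ⬝ᵥ f 0)) := by ring
        _ = c' ^ 4 * (signChar (u' ⬝ᵥ a) * signChar (u' ⬝ᵥ a)) *
            (signChar (u' ⬝ᵥ b) * signChar (u' ⬝ᵥ b)) := by rw [e1, e2, e3, e4]; ring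
        _ = c ^ 4 * 1 := by rw [s2, s3, hc4, mul_one]
    apply Subtype.ext
    change monomialMatrix _ _ * Q.1 = Q.1 * monomialMatrix _ _
    rw [hQ, monomialMatrix_mul, monomialMatrix_mul]
    congr 1
    · ext1 x
      exact add_right_comm x v v'
    · funext x
      change 1 * (c * signChar (u ⬝ᵥ (x + v))) = c * signChar (u ⬝ᵥ x) * 1
      rw [dotProduct_add, AddChar.map_add_eq_mul, huv, mul_one, mul_one, one_mul]
  -- Hence its image under `φ₂` commutes with every `Z^w` and is diagonal.
  have hR : IsDiagonalGate (φ₂ * translationGate v * φ₂⁻¹) := by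
    refine isDiagonalGate_of_commute_phaseGate fun j => ?_
    have h := congrArg (fun A => φ₂ * A * φ₂⁻¹) (hcomm (Pi.single j 1))
    calc _ = φ₂ * (φ₂⁻¹ * phaseGate (Pi.single j 1) * φ₂ * translationGate v) * φ₂⁻¹ := by group
      _ = _ := h.symm
      _ = _ := by group
  have hX := hconj _ hR
  have hP : permGate f * translationGate v * (permGate f)⁻¹ ∈ pauliGroup n := by
    have e : φ₂⁻¹ * (φ₂ * translationGate v * φ₂⁻¹) * φ₂ = translationGate v := by group
    rw [e] at hX
    rw [hX]
    exact conj_mem_pauliGroup h₁ (conj_mem_pauliGroup h₂ (translationGate_mem_pauliGroup v))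
  rw [permGate_inv, translationGate, ← permGate_mul, ← permGate_mul, mem_pauliGroup_iff] at hP
  obtain ⟨t, -, -, -, ht, -⟩ := IsPauliMatrix.of_monomialMatrix (fun _ => one_ne_zero) hP
  exact ⟨t, ht⟩

/-! ### A criterion for the third level -/

/-- The gate of a quadratic permutation `f` for which every `x ↦ f⁻¹(f x + v)` is affine lies in the
third level of the Clifford hierarchy. -/
theorem permGate_mem_cliffordHierarchy_three {n : ℕ} {f : Equiv.Perm (Fin n → ZMod 2)}
    (hquad : ∀ u x y, f (x + y + u) + f (x + y) =
      (f (x + u) + f x) + (f (y + u) + f y) + (f (0 + u) + f 0))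
    (haff : ∀ v x y, f⁻¹ (f (x + y) + v) = f⁻¹ (f x + v) + f⁻¹ (f y + v) + f⁻¹ (f 0 + v)) :
    permGate f ∈ cliffordHierarchy n 3 := by
  intro P hP Q hQ
  change permGate f * P * star (permGate f) * Q * star (permGate f * P * star (permGate f)) ∈
    pauliGroup n
  rw [mem_pauliGroup_iff] at hP hQ ⊢
  obtain ⟨v, w, c, hc, hP⟩ := hP
  obtain ⟨u, r, c', hc', hQ⟩ := hQ
  change IsPauliMatrix (monomialMatrix f (fun _ => 1) * P.1 * star (monomialMatrix f fun _ => 1) *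
    Q.1 * star (monomialMatrix f (fun _ => 1) * P.1 * star (monomialMatrix f fun _ => 1)))
  rw [hP, hQ, monomialMatrix_conj, monomialMatrix_conj]
  have hπ : ∀ x y, (f⁻¹ * Equiv.addRight v * f) (x + y) = (f⁻¹ * Equiv.addRight v * f) x +
    (f⁻¹ * Equiv.addRight v * f) y + (f⁻¹ * Equiv.addRight v * f) 0 := haff v
  generalize f⁻¹ * Equiv.addRight v * f = π at hπ ⊢
  have hu' := conj_addRight hπ u
  generalize π⁻¹ (u + π 0) = u' at hu'
  have hu'x : ∀ x, π⁻¹ (Equiv.addRight u (π x)) = x + u' := fun x =>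
    congrArg (fun σ : Equiv.Perm (Fin n → ZMod 2) => σ x) hu'
  rw [hu']
  simp only [hu'x]
  have key := isPauliMatrix_of_affine u' (c * c' * star c)
    (by rw [mul_pow, mul_pow, ← star_pow, hc, hc']; simp)
    (fun x => w ⬝ᵥ (f (x + u') + f x) + r ⬝ᵥ π x) (fun x y => by
      rw [hquad, hπ]
      simp only [dotProduct_add]
      ring)
  convert key using 2
  funext x
  simp only [dotProduct_add, AddChar.map_add_eq_mul, star_mul', star_signChar, one_mul, star_one,
    mul_one]
  ring

/-! ### A seven-qubit gate that is not semi-Clifford -/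

section Example

variable {n : ℕ} (h : 7 ≤ n)

/-- The quadratic part of the permutation. Coordinates `0, …, 6` stand for the basis
`e₁, e₂, e₃, e₁₂, e₁₃, e₂₃, e₁₂₃` of the augmentation ideal of the exterior algebra on three generators;
the coordinate `S` of the quadratic part is the sum of `x_T x_T'` over the partitions `S = T ⊔ T'`. -/
def exteriorShift (x : Fin n → ZMod 2) (j : Fin n) : ZMod 2 :=
  let y : Fin 7 → ZMod 2 := fun i => x (Fin.castLE h i)
  if (j : ℕ) = 3 then y 0 * y 1
  else if (j : ℕ) = 4 then y 0 * y 2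
  else if (j : ℕ) = 5 then y 1 * y 2
  else if (j : ℕ) = 6 then y 0 * y 5 + y 1 * y 4 + y 2 * y 3
  else 0

/-- The correction to `x + exteriorShift h x` in the inverse permutation: a cubic term in the
coordinate of `e₁₂₃`. -/
def cubicShift (x : Fin n → ZMod 2) (j : Fin n) : ZMod 2 :=
  if (j : ℕ) = 6 then x (Fin.castLE h 0) * x (Fin.castLE h 1) * x (Fin.castLE h 2) else 0

theorem output_cases (j : ℕ) :
    j = 3 ∨ j = 4 ∨ j = 5 ∨ j = 6 ∨ (j ≠ 3 ∧ j ≠ 4 ∧ j ≠ 5 ∧ j ≠ 6) := by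
  omega

/-- The permutation `x ↦ x + exteriorShift h x`. -/
def exteriorPerm : Equiv.Perm (Fin n → ZMod 2) where
  toFun x := x + exteriorShift h x
  invFun x := x + exteriorShift h x + cubicShift h x
  left_inv x := by
    funext j
    rcases output_cases (j : ℕ) with hj | hj | hj | hj | ⟨h3, h4, h5, h6⟩ <;>
      simp [exteriorShift, cubicShift, *] <;> ring_nf <;> reduce_mod_char
  right_inv x := by
    funext j
    rcases output_cases (j : ℕ) with hj | hj | hj | hj | ⟨h3, h4, h5, h6⟩ <;>
      simp [exteriorShift, cubicShift, *] <;> ring_nf <;> reduce_mod_char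

theorem exteriorPerm_apply (x : Fin n → ZMod 2) : exteriorPerm h x = x + exteriorShift h x := rfl

theorem exteriorPerm_inv_apply (x : Fin n → ZMod 2) :
    (exteriorPerm h)⁻¹ x = x + exteriorShift h x + cubicShift h x := rfl

theorem exteriorPerm_quadratic (u x y : Fin n → ZMod 2) :
    exteriorPerm h (x + y + u) + exteriorPerm h (x + y) =
      (exteriorPerm h (x + u) + exteriorPerm h x) + (exteriorPerm h (y + u) + exteriorPerm h y) +
        (exteriorPerm h (0 + u) + exteriorPerm h 0) := by
  funext j
  rcases output_cases (j : ℕ) with hj | hj | hj | hj | ⟨h3, h4, h5, h6⟩ <;>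
    simp [exteriorPerm_apply, exteriorShift, *] <;> ring_nf <;> reduce_mod_char

theorem exteriorPerm_affine (v x y : Fin n → ZMod 2) :
    (exteriorPerm h)⁻¹ (exteriorPerm h (x + y) + v) =
      (exteriorPerm h)⁻¹ (exteriorPerm h x + v) + (exteriorPerm h)⁻¹ (exteriorPerm h y + v) +
        (exteriorPerm h)⁻¹ (exteriorPerm h 0 + v) := by
  funext j
  rcases output_cases (j : ℕ) with hj | hj | hj | hj | ⟨h3, h4, h5, h6⟩ <;>
    simp [exteriorPerm_apply, exteriorPerm_inv_apply, exteriorShift, cubicShift, *] <;>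
    ring_nf <;> reduce_mod_char

/-- The conjugate of `X^v` with `v = e₁₂` is not a translation, since `e₁₂ e₃ ≠ 0` in the exterior
algebra. -/
theorem not_isSemiClifford_exteriorPerm : ¬ IsSemiClifford (permGate (exteriorPerm h)) := by
  intro hs
  obtain ⟨t, ht⟩ := exists_translation_of_isSemiClifford hs (Pi.single (Fin.castLE h 0) 1)
    (Pi.single (Fin.castLE h 1) 1)
  -- The translation vector would have the coordinates `0` and `1` at `e₁₂₃`.
  have h0 := congrFun (ht 0) (Fin.castLE h 6)
  have h1 := congrFun (ht (Pi.single (Fin.castLE h 2) 1)) (Fin.castLE h 6)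
  simp [exteriorPerm_apply, exteriorPerm_inv_apply, exteriorShift, cubicShift] at h0 h1
  rw [← h0] at h1
  revert h1
  decide

end Example

theorem exists_not_isSemiClifford {n : ℕ} (h : 7 ≤ n) :
    ∃ U : Gate n, IsPermutationGate U ∧ U ∈ cliffordHierarchy n 3 ∧ ¬ IsSemiClifford U :=
  ⟨permGate (exteriorPerm h), ⟨_, (permMatrix_eq_monomialMatrix _).symm⟩,
    permGate_mem_cliffordHierarchy_three (exteriorPerm_quadratic h) (exteriorPerm_affine h),
    not_isSemiClifford_exteriorPerm h⟩

theorem mainTheorem5 :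
    IsLeast {n : ℕ | ∃ U : Gate n,
      IsPermutationGate U ∧ U ∈ cliffordHierarchy n 3 ∧ ¬ IsSemiClifford U} 7 ∧
    (∀ n : ℕ, 7 ≤ n → ∃ U : Gate n,
      IsPermutationGate U ∧ U ∈ cliffordHierarchy n 3 ∧ ¬ IsSemiClifford U) ∧
    (∀ n : ℕ, n ≤ 6 → ∀ U : Gate n,
      IsPermutationGate U → U ∈ cliffordHierarchy n 3 → IsSemiClifford U) := by
  refine ⟨⟨exists_not_isSemiClifford le_rfl, ?_⟩, fun n h => exists_not_isSemiClifford h,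
    fun n hn U hU h3 => isSemiClifford_of_le_six hn hU h3⟩
  rintro n ⟨U, hU, h3, hs⟩
  by_contra hn
  exact hs (isSemiClifford_of_le_six (by omega) hU h3)
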